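/- Let $n\ge 2$, let $V=\mathbb R^n$ with its Euclidean inner product, and let $G$ be a finite group of orthogonal transformations of $V$ that is generated by reflections and essential, i.e. $0$ is the only vector of $V$ fixed by all of $G$. Let $\mathcal H\subseteq V$ be the union of the reflection hyperplanes $\ker(g-\mathrm{id})$, where $g$ ranges over the reflections in $G$. Let $\mathbb R[V]^G$ be the algebra of real polynomials on $V$ that are invariant under $(g\cdot f)(x)=f(g^{-1}x)$, and let $\pi_1,\dots,\pi_n$ be any set of basic invariants of $G$, i.e. algebraically independent homogeneous polynomials that generate the algebra $\mathbb R[V]^G$, labelled so that $\deg\pi_1\le\dots\le\deg\pi_n$. For a polynomial $f$ write $V_{\mathbb R}(f)=\{x\in V: f(x)=0\}$. (1) If $f\in\mathbb R[V]^G$ and $\deg f<2\deg\pi_n$, then $V_{\mathbb R}(f)\neq\emptyset$ if and only if $V_{\mathbb R}(f)\cap\mathcal H\neq\emptyset$. Moreover, for such $f$ (in particular for homogeneous $f$), $f\ge 0$ on $V$ if and only if $f\ge 0$ on $\mathcal H$. (2) The degree bound is tight: $V\setminus\mathcal H\ne\emptyset$, and for every $a\in V\setminus\mathcal H$ the polynomial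 $f=\sum_{i=1}^n(\pi_i-\pi_i(a))^2$ lies in $\mathbb R[V]^G$, has degree exactly $2\deg\pi_n$, and $V_{\mathbb R}(f)$ is exactly the orbit $Ga$; so $V_{\mathbb R}(f)$ is nonempty but does not meet $\mathcal H$. -/

import Mathlib

/-- An orthogonal transformation of `ℝⁿ` is a reflection if it is the orthogonal reflection in the
hyperplane `v^⊥` for some nonzero vector `v`. -/
def IsOrthogonalReflection {n : ℕ}
    (g : EuclideanSpace ℝ (Fin n) ≃ₗᵢ[ℝ] EuclideanSpace ℝ (Fin n)) : Prop :=
  ∃ v : EuclideanSpace ℝ (Fin n), v ≠ 0 ∧ g = (Submodule.span ℝ {v})ᗮ.reflection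

/-- A (real) reflection group: a finite group of orthogonal transformations that is generated by
the reflections it contains. -/
structure IsReflectionGroup {n : ℕ}
    (G : Subgroup (EuclideanSpace ℝ (Fin n) ≃ₗᵢ[ℝ] EuclideanSpace ℝ (Fin n))) : Prop where
  finite : Finite G
  closure_reflections : Subgroup.closure {g | g ∈ G ∧ IsOrthogonalReflection g} = G

/-- `G` is essential: no nonzero vector is fixed by all of `G`. -/
def IsEssentialGroup {n : ℕ}
    (G : Subgroup (EuclideanSpace ℝ (Fin n) ≃ₗᵢ[ℝ] EuclideanSpace ℝ (Fin n))) : Prop :=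
  ∀ v : EuclideanSpace ℝ (Fin n), (∀ g ∈ G, g v = v) → v = 0

/-- The reflection arrangement of `G`: the set of the hyperplanes `ker (g - id)` for the
reflections `g` in `G`. -/
def reflectionArrangement {n : ℕ}
    (G : Subgroup (EuclideanSpace ℝ (Fin n) ≃ₗᵢ[ℝ] EuclideanSpace ℝ (Fin n))) :
    Set (Submodule ℝ (EuclideanSpace ℝ (Fin n))) :=
  {H | ∃ g ∈ G, IsOrthogonalReflection g ∧
    H = LinearMap.ker (g.toLinearEquiv.toLinearMap - LinearMap.id)}

/-- The set of points of `ℝⁿ` that lie on some hyperplane of the reflection arrangement. -/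
def arrangementPoints {n : ℕ}
    (G : Subgroup (EuclideanSpace ℝ (Fin n) ≃ₗᵢ[ℝ] EuclideanSpace ℝ (Fin n))) :
    Set (EuclideanSpace ℝ (Fin n)) :=
  ⋃ H ∈ reflectionArrangement G, (H : Set (EuclideanSpace ℝ (Fin n)))

/-- The value of a real polynomial in `n` variables at a point of `ℝⁿ`. -/
noncomputable def polyValue {n : ℕ} (f : MvPolynomial (Fin n) ℝ)
    (x : EuclideanSpace ℝ (Fin n)) : ℝ :=
  MvPolynomial.eval (fun i => x i) f

/-- The real zero set of a polynomial. -/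
def realZeros {n : ℕ} (f : MvPolynomial (Fin n) ℝ) : Set (EuclideanSpace ℝ (Fin n)) :=
  {x | polyValue f x = 0}

/-- The algebra of `G`-invariant polynomials for the action `(g • f)(x) = f (g⁻¹ x)`. As `ℝ` is
infinite, a polynomial is determined by its values. -/
def invariantPolynomials {n : ℕ}
    (G : Subgroup (EuclideanSpace ℝ (Fin n) ≃ₗᵢ[ℝ] EuclideanSpace ℝ (Fin n))) :
    Subalgebra ℝ (MvPolynomial (Fin n) ℝ) where
  carrier := {f | ∀ g ∈ G, ∀ x, polyValue f (g⁻¹ x) = polyValue f x}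
  mul_mem' := by
    intro a b ha hb g hg x
    have h1 := ha g hg x
    have h2 := hb g hg x
    simp only [polyValue, map_mul] at h1 h2 ⊢
    rw [h1, h2]
  add_mem' := by
    intro a b ha hb g hg x
    have h1 := ha g hg x
    have h2 := hb g hg x
    simp only [polyValue, map_add] at h1 h2 ⊢
    rw [h1, h2]
  algebraMap_mem' := by
    intro r g hg x
    simp [polyValue, MvPolynomial.algebraMap_eq]

/-- `p 0, …, p (n - 1)` is a set of basic invariants of `G`: algebraically independent homogeneous
polynomials that generate the algebra of invariants, labelled by nondecreasing degree. -/
structure IsBasicInvariants {n : ℕ}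
    (G : Subgroup (EuclideanSpace ℝ (Fin n) ≃ₗᵢ[ℝ] EuclideanSpace ℝ (Fin n)))
    (p : Fin n → MvPolynomial (Fin n) ℝ) : Prop where
  homogeneous : ∀ i, (p i).IsHomogeneous (p i).totalDegree
  algebraicIndependent : AlgebraicIndependent ℝ p
  adjoin_eq : Algebra.adjoin ℝ (Set.range p) = invariantPolynomials G
  degree_mono : Monotone fun i => (p i).totalDegree

section
open MvPolynomial

/-! Write an invariant `f` as `F(π)` and move in the orbit space, the image of `x ↦ (π₁(x), …,
πₙ(x))`. By `exists_direction` there is a line direction `u` along which `F` is affine and the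
squared norm, itself a polynomial in the `πᵢ`, is constant. The part of `V` lying over such a line
is therefore compact. Off the arrangement the Jacobian of `π` is nonzero
(`polyValue_jacobian_ne_zero`), so the orbit map is locally surjective there, and the line parameter
can be maximal only at a point of the arrangement. Going both ways along the line, the affine
function bounds `f(x)` above and below by values of `f` on the arrangement
(`exists_arrangementPoints_le_and_le`). This settles nonnegativity; for zeros, the arrangement is
connected, being a union of subspaces, and the intermediate value theorem applies.

The Jacobian is handled without its factorization into linear forms. At a complex zero of it,
comparing the point with a tangent vector killed by `dπ` yields a nontrivial stabilizer. A Hurwitz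
argument then shows that zeros cannot be confined to codimension two, so a reflection must fix the
point.

For tightness, invariants separate orbits, and the top-degree part of the sum of squares is a
nonzero sum of squares. -/

theorem exists_forall_notMem_of_forall_ne_top {V ι : Type*} [AddCommGroup V] [Module ℝ V]
    [Finite ι] (S : ι → Submodule ℝ V) (h : ∀ i, S i ≠ ⊤) : ∃ v, ∀ i, v ∉ S i := by
  by_contra! hc
  obtain ⟨i, hi⟩ := Subspace.exists_eq_top_of_iUnion_eq_univ (p := S)
    (Set.eq_univ_of_forall fun v => Set.mem_iUnion.2 (hc v))
  exact h i hi

/-! ### Orbits of linear forms, separation of orbits, and zeros of the Jacobian -/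

section InvariantTheory

variable {n : ℕ}

/-- The linear form `⟪c, ·⟫` as a polynomial. -/
noncomputable def linearForm (c : EuclideanSpace ℝ (Fin n)) : MvPolynomial (Fin n) ℝ :=
  ∑ i, C (c i) * X i

theorem polyValue_linearForm (c x : EuclideanSpace ℝ (Fin n)) :
    polyValue (linearForm c) x = inner ℝ c x := by
  simp [polyValue, linearForm, PiLp.inner_apply, mul_comm]

theorem polyValue_ext {f g : MvPolynomial (Fin n) ℝ} (h : ∀ x, polyValue f x = polyValue g x) :
    f = g :=
  MvPolynomial.funext fun x => h (WithLp.toLp 2 x)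

theorem continuous_polyValue (f : MvPolynomial (Fin n) ℝ) : Continuous (polyValue f) :=
  (MvPolynomial.continuous_eval f).comp (by fun_prop)

variable {G : Subgroup (EuclideanSpace ℝ (Fin n) ≃ₗᵢ[ℝ] EuclideanSpace ℝ (Fin n))}

theorem inner_inv_apply (g : EuclideanSpace ℝ (Fin n) ≃ₗᵢ[ℝ] EuclideanSpace ℝ (Fin n))
    (c x : EuclideanSpace ℝ (Fin n)) : inner ℝ c (g⁻¹ x) = inner ℝ (g c) x := by
  have := g.inner_map_map c (g⁻¹ x)
  rw [← this]
  congr 1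
  exact g.apply_symm_apply x

/-- The polynomial with the orbit of the linear form of `c` as its roots. -/
noncomputable def orbitPolynomial
    (G : Subgroup (EuclideanSpace ℝ (Fin n) ≃ₗᵢ[ℝ] EuclideanSpace ℝ (Fin n))) [Fintype G]
    (c : EuclideanSpace ℝ (Fin n)) : Polynomial (MvPolynomial (Fin n) ℝ) :=
  ∏ g : G, (Polynomial.X - Polynomial.C (linearForm (g.1 c)))

/-- Applying a group element only permutes the roots, by left translation of the index group. -/
theorem coeff_orbitPolynomial_mem [Fintype G] (c : EuclideanSpace ℝ (Fin n)) (k : ℕ) :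
    (orbitPolynomial G c).coeff k ∈ invariantPolynomials G := by
  intro h hh x
  have key : ∀ y : EuclideanSpace ℝ (Fin n), (orbitPolynomial G c).map (eval fun i => y i) =
      ∏ g : G, (Polynomial.X - Polynomial.C (inner ℝ (g.1 c) y)) := by
    intro y
    simp only [orbitPolynomial, Polynomial.map_prod, Polynomial.map_sub, Polynomial.map_X,
      Polynomial.map_C]
    exact Finset.prod_congr rfl fun g _ => by rw [← polyValue_linearForm]; rfl
  have h2 : (orbitPolynomial G c).map (eval fun i => (h⁻¹ x) i) =
      (orbitPolynomial G c).map (eval fun i => x i) := by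
    rw [key, key, ← Equiv.prod_comp (Equiv.mulLeft (⟨h, hh⟩ : G))
      (fun g : G => Polynomial.X - Polynomial.C (inner ℝ (g.1 c) x))]
    refine Finset.prod_congr rfl fun g _ => ?_
    rw [inner_inv_apply]
    rfl
  have := congrArg (fun q => q.coeff k) h2
  rwa [Polynomial.coeff_map, Polynomial.coeff_map] at this

/-- Two algebra homomorphisms agreeing on the invariants relate the orbits of linear forms. -/
theorem prod_linearForm_eq_zero [Fintype G] {A : Type*} [CommRing A] [Algebra ℝ A]
    (φ ψ : MvPolynomial (Fin n) ℝ →ₐ[ℝ] A)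
    (h : ∀ f ∈ invariantPolynomials G, φ f = ψ f) (c : EuclideanSpace ℝ (Fin n)) :
    ∏ g : G, (φ (linearForm c) - ψ (linearForm (g.1 c))) = 0 := by
  have h1 : (orbitPolynomial G c).map φ.toRingHom = (orbitPolynomial G c).map ψ.toRingHom := by
    ext k
    simpa [Polynomial.coeff_map] using h _ (coeff_orbitPolynomial_mem c k)
  -- On the `φ` side the factor of `g = 1` vanishes at this point.
  have h2 := congrArg (Polynomial.eval (φ (linearForm c))) h1
  simp only [orbitPolynomial, Polynomial.map_prod, Polynomial.map_sub, Polynomial.map_X,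
    Polynomial.map_C, Polynomial.eval_prod, Polynomial.eval_sub, Polynomial.eval_X,
    Polynomial.eval_C] at h2
  refine h2.symm.trans (Finset.prod_eq_zero (Finset.mem_univ (1 : G)) ?_)
  simp

/-- If `x` differs from every `g⁻¹ a`, a generic `c` has `⟪c, x⟫ ≠ ⟪c, g⁻¹ a⟫ = ⟪g c, a⟫` for all
`g`. This contradicts `prod_linearForm_eq_zero` for the evaluations at `x` and `a`. -/
theorem eq_orbit_of_forall_invariant [Finite G] {x a : EuclideanSpace ℝ (Fin n)}
    (h : ∀ f ∈ invariantPolynomials G, polyValue f x = polyValue f a) : ∃ g ∈ G, x = g a := by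
  have := Fintype.ofFinite G
  by_contra! hc
  obtain ⟨c, hc'⟩ := exists_forall_notMem_of_forall_ne_top
    (fun g : G => (Submodule.span ℝ {x - g.1⁻¹ a})ᗮ) (by
      intro g hg
      rw [Submodule.orthogonal_eq_top_iff, Submodule.span_singleton_eq_bot, sub_eq_zero] at hg
      exact hc _ (G.inv_mem g.2) hg)
  have h1 := prod_linearForm_eq_zero (G := G) (aeval fun i => x i) (aeval fun i => a i)
    (by intro f hf; simpa [polyValue, aeval_eq_eval] using h f hf) c
  obtain ⟨g, -, hg⟩ := Finset.prod_eq_zero_iff.1 h1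
  refine hc' g ?_
  have e1 := polyValue_linearForm c x
  have e2 := polyValue_linearForm (g.1 c) a
  rw [polyValue, ← aeval_eq_eval] at e1 e2
  rw [Submodule.mem_orthogonal_singleton_iff_inner_left, inner_sub_right, inner_inv_apply]
  rw [← e1, ← e2]
  exact hg

/-- First order Taylor expansion of a polynomial, in the dual numbers. -/
theorem aeval_dualNumber (z w : Fin n → ℂ) (f : MvPolynomial (Fin n) ℝ) :
    aeval (fun i => (TrivSqZeroExt.inl (z i) + TrivSqZeroExt.inr (w i) : TrivSqZeroExt ℂ ℂ)) f =
      TrivSqZeroExt.inl (aeval z f) +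
        TrivSqZeroExt.inr (∑ j, w j * aeval z (pderiv j f)) := by
  induction f using MvPolynomial.induction_on with
  | C r => simp [TrivSqZeroExt.algebraMap_eq_inl']
  | add f g hf hg =>
    simp only [map_add, hf, hg, mul_add, Finset.sum_add_distrib, TrivSqZeroExt.inl_add,
      TrivSqZeroExt.inr_add]
    ring
  | mul_X f i hf =>
    rw [map_mul, hf, aeval_X]
    ext
    · simp
    · simp [pderiv_X, Pi.single_apply, mul_add, Finset.sum_add_distrib, Finset.mul_sum,
        mul_comm, mul_left_comm, apply_ite (aeval z)]

theorem aeval_linearForm (c a b : EuclideanSpace ℝ (Fin n)) :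
    aeval (fun i => (a i : ℂ) + (b i : ℂ) * Complex.I) (linearForm c) =
      ((inner ℝ c a : ℝ) : ℂ) + ((inner ℝ c b : ℝ) : ℂ) * Complex.I := by
  simp [linearForm, PiLp.inner_apply, mul_add, Finset.sum_add_distrib, Finset.mul_sum, mul_comm,
    mul_left_comm]

theorem pderiv_linearForm (c : EuclideanSpace ℝ (Fin n)) (j : Fin n) :
    pderiv j (linearForm c) = C (c j) := by
  simp [linearForm, pderiv_X, Pi.single_apply]

/-- The Jacobian determinant of a family of polynomials. -/
noncomputable def jacobian (p : Fin n → MvPolynomial (Fin n) ℝ) : MvPolynomial (Fin n) ℝ :=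
  (Matrix.of fun i j => pderiv j (p i)).det

/-- The Jacobian of generators of the invariants vanishes only at points (real or complex) with
nontrivial stabilizer. -/
theorem exists_fixing_of_jacobian_eq_zero [Finite G] {p : Fin n → MvPolynomial (Fin n) ℝ}
    (hp : Algebra.adjoin ℝ (Set.range p) = invariantPolynomials G)
    {a b : EuclideanSpace ℝ (Fin n)}
    (h : aeval (fun i => (a i : ℂ) + (b i : ℂ) * Complex.I) (jacobian p) = 0) :
    ∃ g ∈ G, g ≠ 1 ∧ g a = a ∧ g b = b := by
  classical
  have := Fintype.ofFinite G
  set z : Fin n → ℂ := fun i => (a i : ℂ) + (b i : ℂ) * Complex.I with hz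
  rw [jacobian, AlgHom.map_det] at h
  obtain ⟨w, hw0, hw⟩ := Matrix.exists_mulVec_eq_zero_iff.2 h
  by_contra! hc
  -- `φ` evaluates at `z + εw` and `ψ` at `z`. They agree on the generators because `w` is in the
  -- kernel of the Jacobian matrix at `z`.
  let φ : MvPolynomial (Fin n) ℝ →ₐ[ℝ] TrivSqZeroExt ℂ ℂ :=
    aeval (fun i => (TrivSqZeroExt.inl (z i) + TrivSqZeroExt.inr (w i) : TrivSqZeroExt ℂ ℂ))
  let ψ : MvPolynomial (Fin n) ℝ →ₐ[ℝ] TrivSqZeroExt ℂ ℂ :=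
    (TrivSqZeroExt.inlAlgHom ℝ ℂ ℂ).comp (aeval z)
  have hφψ : ∀ f ∈ invariantPolynomials G, φ f = ψ f := by
    rw [← hp]
    intro f hf
    refine AlgHom.eqOn_adjoin_iff.2 ?_ hf
    rintro _ ⟨i, rfl⟩
    have hi := congrFun hw i
    simp only [Matrix.mulVec, dotProduct, AlgHom.mapMatrix_apply, Matrix.map_apply, Matrix.of_apply,
      Pi.zero_apply] at hi
    simp only [φ, ψ, aeval_dualNumber, AlgHom.comp_apply]
    simp only [mul_comm (w _), hi]
    simp
  -- a generic linear form
  let S : Option {g : G // g ≠ 1} → Submodule ℝ (EuclideanSpace ℝ (Fin n)) := fun o => match o with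
    | none => (Submodule.span ℝ {WithLp.toLp 2 fun i => (w i).re})ᗮ ⊓
        (Submodule.span ℝ {WithLp.toLp 2 fun i => (w i).im})ᗮ
    | some g => (Submodule.span ℝ {a - g.1.1⁻¹ a})ᗮ ⊓ (Submodule.span ℝ {b - g.1.1⁻¹ b})ᗮ
  have hS0 : S none ≠ ⊤ := by
    intro ht
    simp only [S, inf_eq_top_iff, Submodule.orthogonal_eq_top_iff,
      Submodule.span_singleton_eq_bot] at ht
    apply hw0
    ext i
    have h1 := congrArg (fun v => v i) ht.1
    have h2 := congrArg (fun v => v i) ht.2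
    exact Complex.ext h1 h2
  obtain ⟨c, hcS⟩ := exists_forall_notMem_of_forall_ne_top S (by
    rintro (_ | g)
    · exact hS0
    · intro ht
      simp only [S, inf_eq_top_iff, Submodule.orthogonal_eq_top_iff,
        Submodule.span_singleton_eq_bot, sub_eq_zero] at ht
      refine hc g.1.1⁻¹ (G.inv_mem g.1.2) ?_ ht.1.symm ht.2.symm
      simpa using g.2)
  have hprod := prod_linearForm_eq_zero φ ψ hφψ c
  rw [← Finset.mul_prod_erase _ _ (Finset.mem_univ (1 : G))] at hprod
  -- For `g ≠ 1` the factor has nonzero constant part `⟪c, z⟫ - ⟪g c, z⟫`, so the factor of `g = 1`,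
  -- which is `ε⟪c, w⟫`, must vanish; the choice of `c` forbids this.
  have hunit : IsUnit (∏ g ∈ Finset.univ.erase (1 : G),
      (φ (linearForm c) - ψ (linearForm (g.1 c)))) := by
    refine Finset.prod_induction _ IsUnit (fun _ _ => IsUnit.mul) isUnit_one fun g hg => ?_
    have hg1 := Finset.ne_of_mem_erase hg
    rw [TrivSqZeroExt.isUnit_iff_isUnit_fst, isUnit_iff_ne_zero]
    intro h0
    simp only [φ, ψ, aeval_dualNumber, AlgHom.comp_apply, hz, aeval_linearForm] at h0
    refine hcS (some ⟨g, hg1⟩) ?_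
    simp only [S, Submodule.mem_inf,
      Submodule.mem_orthogonal_singleton_iff_inner_left, inner_sub_right, inner_inv_apply]
    have hre := congrArg Complex.re h0
    have him := congrArg Complex.im h0
    simp at hre him
    exact ⟨hre, him⟩
  rw [hunit.mul_left_eq_zero] at hprod
  have hsnd := congrArg TrivSqZeroExt.snd hprod
  refine hcS none ?_
  simp only [φ, ψ, aeval_dualNumber, AlgHom.comp_apply, pderiv_linearForm] at hsnd
  simp at hsnd
  simp only [S, Submodule.mem_inf, Submodule.mem_orthogonal_singleton_iff_inner_left,
    PiLp.inner_apply]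
  have hre := congrArg Complex.re hsnd
  have him := congrArg Complex.im hsnd
  simp at hre him
  exact ⟨by simpa [mul_comm] using hre, by simpa [mul_comm] using him⟩

end InvariantTheory
-- Zeros of the Jacobian lie on reflection hyperplanes
section Purity
open Filter Topology
variable {n : ℕ}

/-- A weak form of Hurwitz's theorem: zeros persist under continuous perturbation. -/
theorem exists_zero_near_of_continuous {F : ℝ → ℂ → ℂ} (hF : Continuous (Function.uncurry F))
    (hd : ∀ t, Differentiable ℂ (F t)) (h0 : F 0 0 = 0) (hfin : {s | F 0 s = 0}.Finite)
    {ε : ℝ} (hε : 0 < ε) : ∀ᶠ t in 𝓝 (0 : ℝ), ∃ s, ‖s‖ < ε ∧ F t s = 0 := by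
  obtain ⟨δ, hδ0, hδε, hδ⟩ : ∃ δ, 0 < δ ∧ δ < ε ∧ ∀ s, ‖s‖ = δ → F 0 s ≠ 0 := by
    obtain ⟨δ, hδ, hδ'⟩ := ((Set.Ioo_infinite hε).sdiff (hfin.image norm)).nonempty
    exact ⟨δ, hδ.1, hδ.2, fun s hs h => hδ' ⟨s, h, hs⟩⟩
  have hcomp : IsCompact (Metric.sphere (0 : ℂ) δ) := isCompact_sphere 0 δ
  obtain ⟨s₀, hs₀, hmin⟩ := hcomp.exists_isMinOn (f := fun s => ‖F 0 s‖)
    (NormedSpace.sphere_nonempty.2 hδ0.le)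
    (hF.comp (Continuous.prodMk_right (0 : ℝ))).norm.continuousOn
  set m := ‖F 0 s₀‖ with hm
  have hm0 : 0 < m := norm_pos_iff.2 (hδ s₀ (by simpa using hs₀))
  have h1 : ∀ᶠ t in 𝓝 (0 : ℝ), ∀ s ∈ Metric.sphere (0 : ℂ) δ, m / 2 < ‖F t s‖ := by
    refine hcomp.eventually_forall_of_forall_eventually fun s hs => ?_
    refine (hF.norm.tendsto (0, s)).eventually (lt_mem_nhds ?_)
    have : m ≤ ‖F 0 s‖ := hmin hs
    simp only [Function.uncurry]
    linarith
  have h2 : ∀ᶠ t in 𝓝 (0 : ℝ), ‖F t 0‖ < m / 2 := by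
    have hc : Continuous fun t => ‖F t 0‖ := (hF.comp (Continuous.prodMk_left (0 : ℂ))).norm
    refine (hc.tendsto 0).eventually (gt_mem_nhds ?_)
    simp [h0, hm0]
  filter_upwards [h1, h2] with t ht1 ht2
  by_contra! hc
  have hne : ∀ s ∈ closure (Metric.ball (0 : ℂ) δ), F t s ≠ 0 := by
    rw [closure_ball _ hδ0.ne']
    intro s hs
    exact hc s (lt_of_le_of_lt (by simpa using hs) hδε)
  -- Without a zero in the closed disc, the maximum principle for `1 / F t` bounds `‖F t 0‖` below
  -- by `m / 2`.
  have hdiff : DiffContOnCl ℂ (fun s => (F t s)⁻¹) (Metric.ball 0 δ) :=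
    (hd t).diffContOnCl.inv hne
  have h3 := Complex.norm_le_of_forall_mem_frontier_norm_le Metric.isBounded_ball hdiff
    (C := (m / 2)⁻¹) (by
      intro s hs
      rw [frontier_ball _ hδ0.ne'] at hs
      rw [norm_inv]
      exact inv_anti₀ (by positivity) (ht1 s hs).le)
    (subset_closure (Metric.mem_ball_self hδ0))
  rw [norm_inv] at h3
  have h4 : 0 < ‖F t 0‖ := norm_pos_iff.2 (hne 0 (subset_closure (Metric.mem_ball_self hδ0)))
  exact absurd ((inv_le_inv₀ h4 (half_pos hm0)).1 h3) (not_le.2 ht2)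

/-- The subspace of vectors fixed by `g`. -/
noncomputable def fixedSubspace (g : EuclideanSpace ℝ (Fin n) ≃ₗᵢ[ℝ] EuclideanSpace ℝ (Fin n)) :
    Submodule ℝ (EuclideanSpace ℝ (Fin n)) :=
  LinearMap.ker (g.toLinearEquiv.toLinearMap - LinearMap.id)

theorem mem_fixedSubspace {g : EuclideanSpace ℝ (Fin n) ≃ₗᵢ[ℝ] EuclideanSpace ℝ (Fin n)}
    {x : EuclideanSpace ℝ (Fin n)} : x ∈ fixedSubspace g ↔ g x = x := by
  simp [fixedSubspace, sub_eq_zero]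

theorem fixedSubspace_ne_top {g : EuclideanSpace ℝ (Fin n) ≃ₗᵢ[ℝ] EuclideanSpace ℝ (Fin n)}
    (hg : g ≠ 1) : fixedSubspace g ≠ ⊤ := fun h =>
  hg (LinearIsometryEquiv.ext fun _ => mem_fixedSubspace.1 (h ▸ Submodule.mem_top))

/-- A nontrivial isometry fixing a hyperplane pointwise is a reflection. -/
theorem isOrthogonalReflection_of_sup_span_eq_top
    {g : EuclideanSpace ℝ (Fin n) ≃ₗᵢ[ℝ] EuclideanSpace ℝ (Fin n)} (hg : g ≠ 1)
    {u : EuclideanSpace ℝ (Fin n)} (hu : fixedSubspace g ⊔ Submodule.span ℝ {u} = ⊤) :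
    IsOrthogonalReflection g := by
  obtain ⟨v, hv, hv0⟩ := Submodule.exists_mem_ne_zero_of_ne_bot
    (fun h => fixedSubspace_ne_top hg (Submodule.orthogonal_eq_bot_iff.1 h))
  have huv : inner ℝ v u ≠ 0 := by
    intro h
    have : v ∈ (fixedSubspace g ⊔ Submodule.span ℝ {u})ᗮ := by
      rw [← Submodule.inf_orthogonal]
      exact ⟨hv, Submodule.mem_orthogonal_singleton_iff_inner_left.2 h⟩
    rw [hu] at this
    exact hv0 (by simpa using this)
  -- the orthogonal complement of the fixed space is the line of `v`
  have hline : ∀ y ∈ (fixedSubspace g)ᗮ, ∃ r : ℝ, y = r • v := by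
    intro y hy
    -- This coefficient makes `y - r • v` orthogonal to `u` as well as to the fixed space, hence
    -- zero.
    refine ⟨inner ℝ y u / inner ℝ v u, ?_⟩
    have : y - (inner ℝ y u / inner ℝ v u) • v ∈ (fixedSubspace g ⊔ Submodule.span ℝ {u})ᗮ := by
      rw [← Submodule.inf_orthogonal]
      refine ⟨Submodule.sub_mem _ hy (Submodule.smul_mem _ _ hv),
        Submodule.mem_orthogonal_singleton_iff_inner_left.2 ?_⟩
      rw [inner_sub_left, real_inner_smul_left]
      field_simp
      simp
    rw [hu] at this
    exact sub_eq_zero.1 (by simpa using this)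
  have hgv : g v ∈ (fixedSubspace g)ᗮ := by
    intro w hw
    rw [← mem_fixedSubspace.1 hw, g.inner_map_map]
    exact hv w hw
  obtain ⟨r, hr⟩ := hline _ hgv
  have hneg : g v = -v := by
    have h1 : ‖g v‖ = ‖v‖ := g.norm_map v
    rw [hr, norm_smul, Real.norm_eq_abs] at h1
    have h2 : |r| = 1 := by
      have : ‖v‖ ≠ 0 := norm_ne_zero_iff.2 hv0
      field_simp at h1
      exact h1
    rcases (abs_eq zero_le_one).1 h2 with rfl | rfl
    · have : v ∈ fixedSubspace g := mem_fixedSubspace.2 (by simpa using hr)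
      exact absurd (inner_self_eq_zero.1 (hv v this)) hv0
    · simpa using hr
  refine ⟨v, hv0, LinearIsometryEquiv.ext fun y => ?_⟩
  obtain ⟨f, hf, w, hw, rfl⟩ := (fixedSubspace g).exists_add_mem_mem_orthogonal y
  obtain ⟨t, rfl⟩ := hline w hw
  rw [map_add, map_add, map_smul, map_smul, hneg, mem_fixedSubspace.1 hf,
    Submodule.reflection_orthogonalComplement_singleton_eq_neg,
    Submodule.reflection_mem_subspace_eq_self]
  rw [Submodule.mem_orthogonal_singleton_iff_inner_left]
  exact hv f hf

variable {G : Subgroup (EuclideanSpace ℝ (Fin n) ≃ₗᵢ[ℝ] EuclideanSpace ℝ (Fin n))}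

theorem mem_arrangementPoints {x : EuclideanSpace ℝ (Fin n)} :
    x ∈ arrangementPoints G ↔ ∃ g ∈ G, IsOrthogonalReflection g ∧ g x = x := by
  simp only [arrangementPoints, reflectionArrangement, Set.mem_iUnion, Set.mem_ofPred_eq]
  constructor
  · rintro ⟨H, ⟨g, hg, hr, rfl⟩, hx⟩
    exact ⟨g, hg, hr, mem_fixedSubspace.1 hx⟩
  · rintro ⟨g, hg, hr, hx⟩
    exact ⟨_, ⟨g, hg, hr, rfl⟩, mem_fixedSubspace.2 hx⟩

/-- If the Jacobian vanished at `x`, its zeros on the complex lines `x + t v + ℂ u` would persist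
near `x` for small real `t ≠ 0`. They are real points, each fixed by some `g ≠ 1`, and one `g₀`
occurs infinitely often. Then `g₀` fixes the limit `x`, and `v` lies in its fixed space plus the
line of `u`, against the choice of `v`. -/
theorem polyValue_jacobian_ne_zero [Finite G] {p : Fin n → MvPolynomial (Fin n) ℝ}
    (hp : Algebra.adjoin ℝ (Set.range p) = invariantPolynomials G)
    {x : EuclideanSpace ℝ (Fin n)} (hx : x ∉ arrangementPoints G) :
    polyValue (jacobian p) x ≠ 0 := by
  intro hJ
  obtain ⟨u, hu⟩ := exists_forall_notMem_of_forall_ne_top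
    (fun g : {g : G // g ≠ 1} => fixedSubspace g.1.1)
    (fun g => fixedSubspace_ne_top fun h => g.2 (Subtype.ext h))
  -- These sums are proper subspaces: otherwise `g` would fix a hyperplane pointwise and be a
  -- reflection fixing `x`.
  obtain ⟨v, hv⟩ := exists_forall_notMem_of_forall_ne_top
    (fun g : {g : G // g ≠ 1 ∧ g.1 x = x} => fixedSubspace g.1.1 ⊔ Submodule.span ℝ {u})
    (fun g h => hx (mem_arrangementPoints.2 ⟨g.1.1, g.1.2,
      isOrthogonalReflection_of_sup_span_eq_top (fun h => g.2.1 (Subtype.ext h)) h, g.2.2⟩))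
  let F : ℝ → ℂ → ℂ := fun t s => aeval (fun i => ((x + t • v) i : ℂ) + s * (u i : ℂ)) (jacobian p)
  have hroot : ∀ t s, F t s = 0 → s.im = 0 ∧ ∃ g ∈ G, g ≠ 1 ∧
      g (x + t • v + s.re • u) = x + t • v + s.re • u := by
    intro t s hs
    obtain ⟨g, hg, hg1, ha, hb⟩ := exists_fixing_of_jacobian_eq_zero (p := p) hp
      (a := x + t • v + s.re • u) (b := s.im • u) (by
        rw [← hs]
        simp only [F]
        congr 2
        ext i
        apply Complex.ext <;> simp)
    refine ⟨?_, g, hg, hg1, ha⟩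
    -- The imaginary part of the zero is `s.im • u`, and `u` is fixed by no nontrivial element.
    by_contra him
    refine hu ⟨⟨g, hg⟩, fun h => hg1 (congrArg Subtype.val h)⟩ (mem_fixedSubspace.2 ?_)
    rw [map_smul] at hb
    exact smul_right_injective _ him hb
  have hFc : Continuous (Function.uncurry F) := by
    have : Function.uncurry F = fun q : ℝ × ℂ => aeval
      (fun i => ((x + q.1 • v) i : ℂ) + q.2 * (u i : ℂ)) (jacobian p) := rfl
    rw [this]
    simp only [aeval_def, ← eval_map]
    refine (MvPolynomial.continuous_eval _).comp (continuous_pi fun i => ?_)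
    simp only [PiLp.add_apply, PiLp.smul_apply]
    fun_prop
  have hFd : ∀ t, Differentiable ℂ (F t) := by
    intro t s
    refine (AnalyticAt.aeval_mvPolynomial (fun i => ?_) _).differentiableAt
    exact Differentiable.analyticAt (by fun_prop) s
  have hF0 : F 0 0 = 0 := by
    simp only [F, zero_smul, add_zero, zero_mul]
    have := congrArg (algebraMap ℝ ℂ) hJ
    rw [polyValue, ← aeval_eq_eval, map_zero, ← aeval_algebraMap_apply] at this
    exact this
  have hfin : {s | F 0 s = 0}.Finite := by
    -- The line `x + ℝu` meets each fixed space at most once, since `u` is not in it.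
    have hsub : {s | F 0 s = 0} ⊆ ⋃ g : {g : G // g ≠ 1},
        {s | s.im = 0 ∧ x + s.re • u ∈ fixedSubspace g.1.1} := by
      intro s hs
      obtain ⟨him, g, hg, hg1, hfix⟩ := hroot 0 s hs
      refine Set.mem_iUnion.2 ⟨⟨⟨g, hg⟩, fun h => hg1 (congrArg Subtype.val h)⟩, him, ?_⟩
      simpa [mem_fixedSubspace] using hfix
    refine (Set.finite_iUnion fun g => Set.Subsingleton.finite ?_).subset hsub
    rintro s ⟨hs1, hs2⟩ s' ⟨hs1', hs2'⟩
    refine Complex.ext ?_ (hs1.trans hs1'.symm)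
    by_contra hne
    have h := Submodule.sub_mem _ hs2 hs2'
    rw [add_sub_add_left_eq_sub, ← sub_smul] at h
    exact hu g ((Submodule.smul_mem_iff _ (sub_ne_zero.2 hne)).1 h)
  -- zeros of the Jacobian accumulate at `x`
  have hseq : ∀ k : ℕ, ∃ t : ℝ, t ≠ 0 ∧ |t| < 1 / (k + 1) ∧ ∃ r : ℝ, |r| < 1 / (k + 1) ∧
      ∃ g : {g : G // g ≠ 1}, x + t • v + r • u ∈ fixedSubspace g.1.1 := by
    intro k
    have hk : (0 : ℝ) < 1 / (k + 1) := by positivity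
    have h1 := exists_zero_near_of_continuous hFc hFd hF0 hfin hk
    have h2 : ∀ᶠ t : ℝ in 𝓝 0, |t| < 1 / (k + 1) := by
      refine (continuous_abs.tendsto (0 : ℝ)).eventually (gt_mem_nhds ?_)
      simpa using hk
    have h3 : ∀ᶠ t : ℝ in 𝓝[≠] 0, t ≠ 0 := eventually_mem_nhdsWithin
    obtain ⟨t, ⟨⟨s, hs, hs0⟩, ht⟩, ht0⟩ :=
      (((h1.and h2).filter_mono nhdsWithin_le_nhds).and h3).exists
    obtain ⟨-, g, hg, hg1, hfix⟩ := hroot t s hs0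
    exact ⟨t, ht0, ht, s.re, (Complex.abs_re_le_norm s).trans_lt hs,
      ⟨⟨g, hg⟩, fun h => hg1 (congrArg Subtype.val h)⟩, mem_fixedSubspace.2 hfix⟩
  choose t ht0 ht r hr g hg using hseq
  obtain ⟨g₀, hg₀⟩ := Finite.exists_infinite_fiber g
  have hfreq : ∃ᶠ k in atTop, g k = g₀ := by
    rw [Nat.frequently_atTop_iff_infinite]
    exact Set.infinite_coe_iff.1 hg₀
  have hlim : Tendsto (fun k => x + t k • v + r k • u) atTop (𝓝 x) := by
    have h1 : Tendsto t atTop (𝓝 0) := squeeze_zero_norm (fun k => (ht k).le)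
      tendsto_one_div_add_atTop_nhds_zero_nat
    have h2 : Tendsto r atTop (𝓝 0) := squeeze_zero_norm (fun k => (hr k).le)
      tendsto_one_div_add_atTop_nhds_zero_nat
    simpa using (tendsto_const_nhds.add (h1.smul_const v)).add (h2.smul_const u)
  have hxfix : x ∈ fixedSubspace g₀.1.1 :=
    (Submodule.closed_of_finiteDimensional _).mem_of_frequently_of_tendsto
      (hfreq.mono fun k hk => hk ▸ hg k) hlim
  obtain ⟨k, hk⟩ := hfreq.exists
  refine hv ⟨g₀.1, g₀.2, mem_fixedSubspace.1 hxfix⟩ ?_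
  have h1 : x + t k • v + r k • u ∈ fixedSubspace g₀.1.1 := hk ▸ hg k
  rw [← Submodule.smul_mem_iff _ (ht0 k)]
  have h2 : t k • v = (x + t k • v + r k • u - x) + (-r k) • u := by module
  rw [h2]
  exact Submodule.add_mem_sup (Submodule.sub_mem _ h1 hxfix)
    (Submodule.smul_mem _ _ (Submodule.mem_span_singleton_self u))

end Purity
-- Local surjectivity of the orbit map and extremal points of its fibres
section LocalSurjectivity
open Filter Topology
variable {n : ℕ}

theorem hasStrictFDerivAt_polyValue (f : MvPolynomial (Fin n) ℝ) (x : EuclideanSpace ℝ (Fin n)) :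
    HasStrictFDerivAt (polyValue f)
      (∑ j, polyValue (pderiv j f) x • (EuclideanSpace.proj j : EuclideanSpace ℝ (Fin n) →L[ℝ] ℝ))
      x := by
  induction f using MvPolynomial.induction_on with
  | C r =>
    have : polyValue (C r : MvPolynomial (Fin n) ℝ) = fun _ => r := by ext; simp [polyValue]
    rw [this]
    simpa [polyValue] using hasStrictFDerivAt_const r x
  | add f g hf hg =>
    have : polyValue (f + g) = polyValue f + polyValue g := by ext; simp [polyValue]
    rw [this]
    refine (hf.add hg).congr_fderiv ?_
    ext v
    simp [polyValue, add_mul, Finset.sum_add_distrib]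
  | mul_X f i hf =>
    have : polyValue (f * X i) = fun y => polyValue f y *
        (EuclideanSpace.proj i : EuclideanSpace ℝ (Fin n) →L[ℝ] ℝ) y := by ext; simp [polyValue]
    rw [this]
    refine (hf.mul (ContinuousLinearMap.hasStrictFDerivAt _)).congr_fderiv ?_
    ext v
    simp [polyValue, pderiv_X, Pi.single_apply, mul_add, Finset.sum_add_distrib, Finset.mul_sum,
      mul_comm, mul_left_comm, apply_ite (eval _)]

variable {G : Subgroup (EuclideanSpace ℝ (Fin n) ≃ₗᵢ[ℝ] EuclideanSpace ℝ (Fin n))}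

/-- The orbit map given by a family of polynomials. -/
noncomputable def orbitMap (p : Fin n → MvPolynomial (Fin n) ℝ) (x : EuclideanSpace ℝ (Fin n)) :
    Fin n → ℝ :=
  fun i => polyValue (p i) x

theorem continuous_orbitMap (p : Fin n → MvPolynomial (Fin n) ℝ) : Continuous (orbitMap p) :=
  continuous_pi fun i => continuous_polyValue (p i)

/-- Away from the reflection hyperplanes the orbit map is locally surjective. -/
theorem eventually_exists_orbitMap_eq [Finite G] {p : Fin n → MvPolynomial (Fin n) ℝ}
    (hp : Algebra.adjoin ℝ (Set.range p) = invariantPolynomials G)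
    {x : EuclideanSpace ℝ (Fin n)} (hx : x ∉ arrangementPoints G) (u : Fin n → ℝ) :
    ∀ᶠ t : ℝ in 𝓝 0, ∃ y, orbitMap p y = orbitMap p x + t • u := by
  have hder : HasStrictFDerivAt (orbitMap p) (ContinuousLinearMap.pi fun i =>
      ∑ j, polyValue (pderiv j (p i)) x •
        (EuclideanSpace.proj j : EuclideanSpace ℝ (Fin n) →L[ℝ] ℝ)) x :=
    hasStrictFDerivAt_pi.2 fun i => hasStrictFDerivAt_polyValue (p i) x
  set A : Matrix (Fin n) (Fin n) ℝ := Matrix.of fun i j => polyValue (pderiv j (p i)) x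
  have hdet : A.det ≠ 0 := by
    have h := polyValue_jacobian_ne_zero hp hx
    rw [jacobian, polyValue, RingHom.map_det] at h
    exact h
  have hsurj := Matrix.mulVec_surjective_iff_isUnit.2
    ((Matrix.isUnit_iff_isUnit_det A).2 hdet.isUnit)
  have hmap := hder.map_nhds_eq_of_surj (LinearMap.range_eq_top.2 fun y => by
    obtain ⟨w, hw⟩ := hsurj y
    refine ⟨WithLp.toLp 2 w, ?_⟩
    rw [← hw]
    ext i
    simp [A, Matrix.mulVec, dotProduct])
  have hrange : Set.range (orbitMap p) ∈ 𝓝 (orbitMap p x) := by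
    rw [← hmap]
    exact Filter.range_mem_map
  have hc : Tendsto (fun t : ℝ => orbitMap p x + t • u) (𝓝 0) (𝓝 (orbitMap p x)) := by
    have : Continuous fun t : ℝ => orbitMap p x + t • u := by fun_prop
    simpa using this.tendsto 0
  exact hc hrange

/-- The extremes of a fibre of the orbit map over a line lie in the arrangement. -/
theorem exists_mem_arrangementPoints_of_isCompact [Finite G]
    {p : Fin n → MvPolynomial (Fin n) ℝ}
    (hp : Algebra.adjoin ℝ (Set.range p) = invariantPolynomials G)
    {x : EuclideanSpace ℝ (Fin n)} {u : Fin n → ℝ} (hu : u ≠ 0)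
    (hK : Bornology.IsBounded {y | ∃ t : ℝ, orbitMap p y = orbitMap p x + t • u}) :
    ∃ y ∈ arrangementPoints G, ∃ t : ℝ, 0 ≤ t ∧ orbitMap p y = orbitMap p x + t • u := by
  obtain ⟨j, hj⟩ := Function.ne_iff.1 hu
  set K := {y | ∃ t : ℝ, orbitMap p y = orbitMap p x + t • u} with hKdef
  -- A coordinate with `u j ≠ 0` recovers the line parameter continuously.
  let τ : EuclideanSpace ℝ (Fin n) → ℝ := fun y => (orbitMap p y j - orbitMap p x j) / u j
  have hτ : ∀ y t, orbitMap p y = orbitMap p x + t • u → τ y = t := by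
    intro y t h
    simp only [τ, h, Pi.add_apply, Pi.smul_apply, smul_eq_mul, add_sub_cancel_left]
    exact mul_div_cancel_right₀ t hj
  have hτc : Continuous τ :=
    (((continuous_apply j).comp (continuous_orbitMap p)).sub continuous_const).div_const _
  have hKeq : K = {y | orbitMap p y = orbitMap p x + τ y • u} := by
    ext y
    exact ⟨fun ⟨t, h⟩ => by simpa [hτ y t h] using h, fun h => ⟨τ y, h⟩⟩
  have hKclosed : IsClosed K := by
    rw [hKeq]
    exact isClosed_eq (continuous_orbitMap p) (continuous_const.add (hτc.smul continuous_const))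
  have hxK : x ∈ K := ⟨0, by simp⟩
  obtain ⟨y, ⟨t, hy⟩, hmax⟩ := (Metric.isCompact_of_isClosed_isBounded hKclosed hK).exists_isMaxOn
    ⟨x, hxK⟩ hτc.continuousOn
  have hmax' : ∀ z s, orbitMap p z = orbitMap p x + s • u → s ≤ t := by
    intro z s hz
    have : τ z ≤ τ y := hmax ⟨s, hz⟩
    rwa [hτ z s hz, hτ y t hy] at this
  refine ⟨y, ?_, t, hmax' x 0 (by simp), hy⟩
  -- Off the arrangement, local surjectivity would realize a slightly larger parameter.
  by_contra hyH
  have h1 := (eventually_exists_orbitMap_eq hp hyH u).filter_mono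
    (nhdsWithin_le_nhds (s := Set.Ioi 0))
  obtain ⟨s, ⟨z, hz⟩, hs⟩ := (h1.and eventually_mem_nhdsWithin).exists
  have := hmax' z (t + s) (by rw [hz, hy]; module)
  have hs' : 0 < s := hs
  linarith

end LocalSurjectivity

/-! ### Degrees of polynomials in the basic invariants -/

section Degrees
variable {n : ℕ} {G : Subgroup (EuclideanSpace ℝ (Fin n) ≃ₗᵢ[ℝ] EuclideanSpace ℝ (Fin n))}
  {p : Fin n → MvPolynomial (Fin n) ℝ}

theorem homogeneousComponent_aeval {d : Fin n → ℕ} (hp : ∀ i, (p i).IsHomogeneous (d i)) (k : ℕ)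
    (F : MvPolynomial (Fin n) ℝ) :
    homogeneousComponent k (aeval p F) = aeval p (weightedHomogeneousComponent d k F) := by
  induction F using MvPolynomial.induction_on' with
  | add F₁ F₂ h₁ h₂ => simp only [map_add, h₁, h₂]
  | monomial m r =>
    have hhom : (aeval p (monomial m r)).IsHomogeneous (Finsupp.weight d m) := by
      rw [aeval_monomial, Finsupp.weight_apply, algebraMap_eq]
      refine IsHomogeneous.C_mul ?_ r
      refine IsHomogeneous.prod _ _ (fun i => m i • d i) fun i _ => ?_
      rw [smul_eq_mul, mul_comm]
      exact (hp i).pow _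
    rw [homogeneousComponent_of_mem ((mem_homogeneousSubmodule _ _).2 hhom),
      weightedHomogeneousComponent_of_mem
        ((mem_weightedHomogeneousSubmodule _ _ _ _).2 (isWeightedHomogeneous_monomial d m r rfl))]
    split_ifs <;> simp

/-- Algebraic independence rules out cancellation: a nonzero weighted component of `F` gives a
nonzero homogeneous component of `aeval p F`. -/
theorem weight_le_totalDegree_aeval {d : Fin n → ℕ} (hp : ∀ i, (p i).IsHomogeneous (d i))
    (hind : AlgebraicIndependent ℝ p) {F : MvPolynomial (Fin n) ℝ} {m : Fin n →₀ ℕ}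
    (hm : m ∈ F.support) : Finsupp.weight d m ≤ (aeval p F).totalDegree := by
  by_contra! h
  have h1 := homogeneousComponent_aeval hp (Finsupp.weight d m) F
  rw [homogeneousComponent_eq_zero _ _ h] at h1
  have h2 : weightedHomogeneousComponent d (Finsupp.weight d m) F = 0 :=
    hind (by rw [← h1, map_zero])
  have h3 := congrArg (coeff m) h2
  rw [coeff_weightedHomogeneousComponent, if_pos rfl, coeff_zero] at h3
  exact mem_support_iff.1 hm h3

theorem IsBasicInvariants.mem (hp : IsBasicInvariants G p) (i : Fin n) :
    p i ∈ invariantPolynomials G :=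
  by
  rw [← hp.adjoin_eq]
  exact Algebra.subset_adjoin (Set.mem_range_self i)

theorem IsBasicInvariants.exists_aeval_eq (hp : IsBasicInvariants G p)
    {f : MvPolynomial (Fin n) ℝ} (hf : f ∈ invariantPolynomials G) : 
    ∃ F : MvPolynomial (Fin n) ℝ, aeval p F = f := by
  rw [← hp.adjoin_eq, Algebra.adjoin_range_eq_range_aeval] at hf
  exact hf

/-- Constants are not transcendental, and an invariant linear form is `⟪c, ·⟫` with `c` fixed by
`G`, so `c = 0` by essentiality. -/
theorem IsBasicInvariants.two_le_totalDegree (hp : IsBasicInvariants G p)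
    (hess : IsEssentialGroup G) (i : Fin n) : 2 ≤ (p i).totalDegree := by
  have hhom := hp.homogeneous i
  have htr := hp.algebraicIndependent.transcendental i
  have h0 : (p i).totalDegree ≠ 0 := by
    intro h
    rw [totalDegree_eq_zero_iff_eq_C] at h
    rw [h] at htr
    exact htr (isAlgebraic_algebraMap _)
  have h1 : (p i).totalDegree ≠ 1 := by
    intro h
    rw [h, ← mem_homogeneousSubmodule, homogeneousSubmodule_one_eq_span_X,
      Submodule.mem_span_range_iff_exists_fun] at hhom
    obtain ⟨c, hc⟩ := hhom
    have hlin : p i = linearForm (WithLp.toLp 2 c) := by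
      rw [← hc]
      simp [linearForm, smul_eq_C_mul]
    have hc0 : (WithLp.toLp 2 c : EuclideanSpace ℝ (Fin n)) = 0 := by
      refine hess _ fun g hg => ?_
      refine ext_inner_right ℝ fun x => ?_
      have := hp.mem i g hg x
      rwa [hlin, polyValue_linearForm, polyValue_linearForm, inner_inv_apply] at this
    rw [hlin, hc0] at h
    simp [linearForm] at h
  omega

/-- The squared norm as a polynomial. -/
noncomputable def normSqPoly (n : ℕ) : MvPolynomial (Fin n) ℝ := ∑ i, X i ^ 2

theorem polyValue_normSqPoly (x : EuclideanSpace ℝ (Fin n)) :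
    polyValue (normSqPoly n) x = ‖x‖ ^ 2 := by
  simp [polyValue, normSqPoly, EuclideanSpace.norm_sq_eq]

theorem normSqPoly_mem : normSqPoly n ∈ invariantPolynomials G := by
  intro g _ x
  rw [polyValue_normSqPoly, polyValue_normSqPoly, LinearIsometryEquiv.norm_map]

theorem totalDegree_normSqPoly_le : (normSqPoly n).totalDegree ≤ 2 :=
  (totalDegree_finsetSum_le fun i _ => (totalDegree_pow _ _).trans (by simp))

/-- A polynomial whose monomials have degree at most one in the variables moved by `u` is affine
along lines in direction `u`. -/
theorem exists_affine_of_support {F : MvPolynomial (Fin n) ℝ} {u : Fin n → ℝ}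
    (h : ∀ m ∈ F.support, ∑ i with u i ≠ 0, m i ≤ 1) (y : Fin n → ℝ) :
    ∃ β : ℝ, ∀ t : ℝ, eval (y + t • u) F = eval y F + t * β := by
  set P : Polynomial ℝ :=
    aeval (fun i => Polynomial.C (y i) + Polynomial.C (u i) * Polynomial.X) F with hP
  have hPe : ∀ t, P.eval t = eval (y + t • u) F := by
    intro t
    have hcomp : ((Polynomial.aeval t).comp
        (aeval fun i => Polynomial.C (y i) + Polynomial.C (u i) * Polynomial.X)) =
        (aeval (y + t • u) : MvPolynomial (Fin n) ℝ →ₐ[ℝ] ℝ) := by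
      ext i
      simp only [AlgHom.comp_apply, aeval_X, map_add, map_mul, Polynomial.aeval_C,
        Polynomial.aeval_X, Algebra.algebraMap_self, RingHom.id_apply, Pi.add_apply, Pi.smul_apply,
        smul_eq_mul]
      ring
    simpa [aeval_eq_eval, Polynomial.coe_aeval_eq_eval] using DFunLike.congr_fun hcomp F
  have hdeg : P.natDegree ≤ 1 := by
    rw [hP, aeval_def, eval₂_eq']
    refine Polynomial.natDegree_sum_le_of_forall_le _ _ fun m hm => ?_
    refine (Polynomial.natDegree_C_mul_le _ _).trans ?_
    refine (Polynomial.natDegree_prod_le _ _).trans (le_trans ?_ (h m hm))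
    rw [Finset.sum_filter]
    refine Finset.sum_le_sum fun i _ => Polynomial.natDegree_pow_le.trans ?_
    split_ifs with hi
    · refine (Nat.mul_le_mul_left (m i) ?_).trans (mul_one _).le
      compute_degree
    · simp [not_not.1 hi]
  obtain ⟨β, c, hPc⟩ := Polynomial.exists_eq_X_add_C_of_natDegree_le_one hdeg
  refine ⟨β, fun t => ?_⟩
  have h0 := hPe 0
  rw [zero_smul, add_zero] at h0
  rw [← hPe, ← h0, hPc]
  simp only [Polynomial.eval_add, Polynomial.eval_mul, Polynomial.eval_C, Polynomial.eval_X]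
  ring

end Degrees
-- Bounding values by the arrangement, and tightness
section Main
variable {n : ℕ} {G : Subgroup (EuclideanSpace ℝ (Fin n) ≃ₗᵢ[ℝ] EuclideanSpace ℝ (Fin n))}
  {p : Fin n → MvPolynomial (Fin n) ℝ}

theorem polyValue_aeval (F : MvPolynomial (Fin n) ℝ) (x : EuclideanSpace ℝ (Fin n)) :
    polyValue (aeval p F) x = eval (orbitMap p x) F := by
  rw [polyValue, ← aeval_eq_eval, comp_aeval_apply, ← aeval_eq_eval]
  rfl

theorem exists_eq_C_add_sum_of_totalDegree_le_one {B : MvPolynomial (Fin n) ℝ}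
    (h : B.totalDegree ≤ 1) : ∃ (c : ℝ) (b : Fin n → ℝ), B = C c + ∑ i, b i • X i := by
  have h1 := homogeneousComponent_mem 1 B
  rw [homogeneousSubmodule_one_eq_span_X, Submodule.mem_span_range_iff_exists_fun] at h1
  obtain ⟨b, hb⟩ := h1
  refine ⟨coeff 0 B, b, ?_⟩
  rw [hb, ← homogeneousComponent_zero, ← Finset.sum_range_one (fun k => homogeneousComponent k B),
    ← Finset.sum_range_succ]
  conv_lhs => rw [← sum_homogeneousComponent B]
  refine Finset.sum_subset (Finset.range_mono (by omega)) fun k _ hk => ?_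
  refine homogeneousComponent_eq_zero _ _ ?_
  simp at hk
  omega

theorem weight_eq_sum (d : Fin n → ℕ) (m : Fin n →₀ ℕ) :
    Finsupp.weight d m = ∑ i, m i * d i := by
  rw [Finsupp.weight_apply, Finsupp.sum_fintype _ _ (by simp)]
  rfl

theorem two_mul_sum_le_weight {d : Fin n → ℕ} (hd : ∀ i, 2 ≤ d i) (m : Fin n →₀ ℕ) :
    2 * ∑ i, m i ≤ Finsupp.weight d m := by
  rw [weight_eq_sum, Finset.mul_sum]
  exact Finset.sum_le_sum fun i _ => by rw [mul_comm]; exact Nat.mul_le_mul_left _ (hd i)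

/-- An invariant of degree below twice the top degree is affine along some line of the orbit space
on which the norm is constant. -/
theorem exists_direction (hn : 2 ≤ n) (hess : IsEssentialGroup G) (hp : IsBasicInvariants G p)
    {F : MvPolynomial (Fin n) ℝ} {l : Fin n}
    (hF : (aeval p F).totalDegree < 2 * (p l).totalDegree) :
    ∃ u : Fin n → ℝ, u ≠ 0 ∧ (∀ m ∈ F.support, ∑ i with u i ≠ 0, m i ≤ 1) ∧
      ∀ x y : EuclideanSpace ℝ (Fin n), ∀ t : ℝ, orbitMap p y = orbitMap p x + t • u →
        ‖y‖ = ‖x‖ := by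
  have hd := hp.two_le_totalDegree hess
  have hFw : ∀ m ∈ F.support, Finsupp.weight (fun i => (p i).totalDegree) m <
      2 * (p l).totalDegree := fun m hm =>
    (weight_le_totalDegree_aeval hp.homogeneous hp.algebraicIndependent hm).trans_lt hF
  obtain ⟨B, hB⟩ := hp.exists_aeval_eq (normSqPoly_mem (G := G))
  have hBw : ∀ m ∈ B.support, Finsupp.weight (fun i => (p i).totalDegree) m ≤ 2 := fun m hm =>
    (weight_le_totalDegree_aeval hp.homogeneous hp.algebraicIndependent hm).trans
      (hB ▸ totalDegree_normSqPoly_le)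
  have hBdeg : B.totalDegree ≤ 1 := by
    rw [totalDegree, Finset.sup_le_iff]
    intro m hm
    have h1 := two_mul_sum_le_weight hd m
    have h2 := hBw m hm
    rw [Finsupp.sum_fintype _ _ (by simp)]
    omega
  obtain ⟨c, b, hcb⟩ := exists_eq_C_add_sum_of_totalDegree_le_one hBdeg
  have hnorm : ∀ x : EuclideanSpace ℝ (Fin n), ‖x‖ ^ 2 = c + ∑ i, b i * orbitMap p x i := by
    intro x
    rw [← polyValue_normSqPoly, ← hB, polyValue_aeval, hcb]
    simp [smul_eval]
  have hconst : ∀ u : Fin n → ℝ, ∑ i, b i * u i = 0 →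
      ∀ x y : EuclideanSpace ℝ (Fin n), ∀ t : ℝ, orbitMap p y = orbitMap p x + t • u →
        ‖y‖ = ‖x‖ := by
    intro u hu x y t h
    rw [← sq_eq_sq₀ (norm_nonneg _) (norm_nonneg _), hnorm, hnorm, h]
    have : ∑ i, b i * (orbitMap p x + t • u) i =
        ∑ i, b i * orbitMap p x i + t * ∑ i, b i * u i := by
      rw [Finset.mul_sum, ← Finset.sum_add_distrib]
      exact Finset.sum_congr rfl fun i _ => by simp; ring
    rw [this, hu, mul_zero, add_zero]
  -- If the squared norm does not involve the top invariant, move that coordinate alone: the weight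
  -- bound allows it at most once in a monomial of `F`.
  by_cases hbl : b l = 0
  · refine ⟨Pi.single l 1, by simp, fun m hm => ?_, hconst _ (by simp [Pi.single_apply, hbl])⟩
    have h1 := hFw m hm
    rw [weight_eq_sum] at h1
    have h2 : m l * (p l).totalDegree ≤ ∑ i, m i * (p i).totalDegree :=
      Finset.single_le_sum (f := fun i => m i * (p i).totalDegree) (fun _ _ => Nat.zero_le _)
        (Finset.mem_univ l)
    have h3 : m l < 2 := lt_of_mul_lt_mul_right (h2.trans_lt h1) (Nat.zero_le _)
    have h4 : (Finset.univ.filter fun i => (Pi.single l 1 : Fin n → ℝ) i ≠ 0) = {l} := by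
      ext i
      simp [Pi.single_apply]
    rw [h4, Finset.sum_singleton]
    omega
  -- Here the weights in `F` are below 4 while each variable weighs at least 2, so `F` is affine and
  -- any nonzero `u` orthogonal to `b` serves; it exists as `n ≥ 2`.
  · have hdl : (p l).totalDegree ≤ 2 := by
      have hmem : Finsupp.single l 1 ∈ B.support := by
        rw [mem_support_iff, hcb]
        have h0 : (0 : Fin n →₀ ℕ) ≠ Finsupp.single l 1 := (by simp : Finsupp.single l 1 ≠ 0).symm
        simpa [coeff_sum, coeff_X, Finsupp.single_left_inj, coeff_C, h0] using hbl
      simpa [Finsupp.weight_single] using hBw _ hmem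
    have : Nontrivial (Fin n) := Fin.nontrivial_iff_two_le.2 hn
    obtain ⟨k, hkl⟩ := exists_ne l
    refine ⟨Pi.single k (b l) - Pi.single l (b k), ?_, fun m hm => ?_,
      hconst _ ?_⟩
    · intro h
      have := congrFun h k
      simp [hkl, hbl] at this
    · have h1 := hFw m hm
      have h2 := two_mul_sum_le_weight hd m
      refine (Finset.sum_le_univ_sum_of_nonneg fun _ => Nat.zero_le _).trans ?_
      omega
    · simp [mul_sub, Pi.single_apply, Finset.sum_sub_distrib, mul_comm]

/-- The values of an invariant of small degree are bounded by its values on the arrangement. -/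
theorem exists_arrangementPoints_le_and_le [Finite G] (hn : 2 ≤ n) (hess : IsEssentialGroup G)
    (hp : IsBasicInvariants G p) {f : MvPolynomial (Fin n) ℝ} (hf : f ∈ invariantPolynomials G)
    {l : Fin n} (hdeg : f.totalDegree < 2 * (p l).totalDegree)
    (x : EuclideanSpace ℝ (Fin n)) :
    (∃ y ∈ arrangementPoints G, polyValue f y ≤ polyValue f x) ∧
      ∃ y ∈ arrangementPoints G, polyValue f x ≤ polyValue f y := by
  obtain ⟨F, rfl⟩ := hp.exists_aeval_eq hf
  obtain ⟨u, hu, hsupp, hnorm⟩ := exists_direction hn hess hp hdeg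
  obtain ⟨β, hβ⟩ := exists_affine_of_support hsupp (orbitMap p x)
  have hbdd : ∀ ε : ℝ, Bornology.IsBounded
      {y | ∃ t : ℝ, orbitMap p y = orbitMap p x + t • ε • u} := by
    intro ε
    refine (Metric.isBounded_closedBall (x := 0) (r := ‖x‖)).subset ?_
    rintro y ⟨t, ht⟩
    rw [smul_smul] at ht
    simpa using (hnorm x y _ ht).le
  have hpoint : ∀ ε : ℝ, ε ≠ 0 → ∃ y ∈ arrangementPoints G, ∃ t : ℝ, 0 ≤ t ∧
      polyValue (aeval p F) y = polyValue (aeval p F) x + t * (ε * β) := by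
    intro ε hε
    obtain ⟨y, hy, t, ht, hyt⟩ := exists_mem_arrangementPoints_of_isCompact hp.adjoin_eq
      (smul_ne_zero hε hu) (hbdd ε)
    refine ⟨y, hy, t, ht, ?_⟩
    rw [polyValue_aeval, polyValue_aeval, hyt, smul_smul, hβ]
    ring
  -- The two ends of the line: the sign of the slope `β` decides which gives the upper bound.
  obtain ⟨y₁, hy₁, t₁, ht₁, h₁⟩ := hpoint 1 one_ne_zero
  obtain ⟨y₂, hy₂, t₂, ht₂, h₂⟩ := hpoint (-1) (by norm_num)
  rcases le_total 0 β with hb | hb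
  · exact ⟨⟨y₂, hy₂, by nlinarith⟩, ⟨y₁, hy₁, by nlinarith⟩⟩
  · exact ⟨⟨y₁, hy₁, by nlinarith⟩, ⟨y₂, hy₂, by nlinarith⟩⟩

theorem starConvex_arrangementPoints : StarConvex ℝ 0 (arrangementPoints G) := by
  intro y hy a b _ _ _
  obtain ⟨g, hg, hr, hfix⟩ := mem_arrangementPoints.1 hy
  exact mem_arrangementPoints.2 ⟨g, hg, hr, by simp [hfix]⟩

theorem exists_zero_mem_arrangementPoints {f : MvPolynomial (Fin n) ℝ}
    {y₁ y₂ : EuclideanSpace ℝ (Fin n)} (hy₁ : y₁ ∈ arrangementPoints G)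
    (hy₂ : y₂ ∈ arrangementPoints G) (h₁ : polyValue f y₁ ≤ 0) (h₂ : 0 ≤ polyValue f y₂) :
    ∃ y ∈ arrangementPoints G, polyValue f y = 0 := by
  have hconn := (starConvex_arrangementPoints (G := G)).isPathConnected
    (by simpa using starConvex_arrangementPoints.smul_mem hy₁ le_rfl zero_le_one)
  exact hconn.isConnected.isPreconnected.intermediate_value hy₁ hy₂
    (continuous_polyValue f).continuousOn ⟨h₁, h₂⟩

theorem IsOrthogonalReflection.ne_one
    {g : EuclideanSpace ℝ (Fin n) ≃ₗᵢ[ℝ] EuclideanSpace ℝ (Fin n)}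
    (hg : IsOrthogonalReflection g) : g ≠ 1 := by
  obtain ⟨v, hv, rfl⟩ := hg
  intro h
  have h1 := Submodule.reflection_orthogonalComplement_singleton_eq_neg (𝕜 := ℝ) v
  rw [h] at h1
  have h2 : (2 : ℝ) • v = 0 := by
    rw [two_smul]
    exact add_eq_zero_iff_eq_neg.2 h1
  exact hv ((smul_eq_zero.1 h2).resolve_left two_ne_zero)

theorem exists_notMem_arrangementPoints [Finite G] : ∃ a, a ∉ arrangementPoints G := by
  obtain ⟨a, ha⟩ := exists_forall_notMem_of_forall_ne_top
    (fun g : {g : G // g ≠ 1} => fixedSubspace g.1.1)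
    (fun g => fixedSubspace_ne_top fun h => g.2 (Subtype.ext h))
  refine ⟨a, fun hmem => ?_⟩
  obtain ⟨g, hg, hr, hfix⟩ := mem_arrangementPoints.1 hmem
  exact ha ⟨⟨g, hg⟩, fun h => hr.ne_one (congrArg Subtype.val h)⟩ (mem_fixedSubspace.2 hfix)

theorem IsOrthogonalReflection.conj
    {r : EuclideanSpace ℝ (Fin n) ≃ₗᵢ[ℝ] EuclideanSpace ℝ (Fin n)}
    (hr : IsOrthogonalReflection r)
    (g : EuclideanSpace ℝ (Fin n) ≃ₗᵢ[ℝ] EuclideanSpace ℝ (Fin n)) :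
    IsOrthogonalReflection (g⁻¹ * r * g) := by
  obtain ⟨v, hv, rfl⟩ := hr
  refine ⟨g⁻¹ v, by simpa using hv, ?_⟩
  ext1 y
  have h1 : inner ℝ (g⁻¹ v) y = inner ℝ v (g y) := by rw [← inner_inv_apply, inv_inv]
  have h2 : g⁻¹ (g y) = y := g.symm_apply_apply y
  change g⁻¹ ((Submodule.span ℝ {v})ᗮ.reflection (g y)) = _
  simp only [Submodule.reflection_orthogonal_apply, Submodule.reflection_singleton_apply, map_neg,
    map_sub, map_nsmul, map_smul, h1, h2, LinearIsometryEquiv.norm_map]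

theorem mem_arrangementPoints_of_apply_mem
    {g : EuclideanSpace ℝ (Fin n) ≃ₗᵢ[ℝ] EuclideanSpace ℝ (Fin n)} (hg : g ∈ G)
    {a : EuclideanSpace ℝ (Fin n)} (h : g a ∈ arrangementPoints G) : a ∈ arrangementPoints G := by
  obtain ⟨r, hr, hrefl, hfix⟩ := mem_arrangementPoints.1 h
  refine mem_arrangementPoints.2 ⟨g⁻¹ * r * g, G.mul_mem (G.mul_mem (G.inv_mem hg) hr) hg,
    hrefl.conj g, ?_⟩
  change g⁻¹ (r (g a)) = a
  rw [hfix]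
  exact g.symm_apply_apply a

/-- The sum of squares `∑ (pᵢ - pᵢ(a))²`. -/
noncomputable def orbitSOS (p : Fin n → MvPolynomial (Fin n) ℝ) (a : EuclideanSpace ℝ (Fin n)) :
    MvPolynomial (Fin n) ℝ :=
  ∑ i, (p i - C (polyValue (p i) a)) ^ 2

theorem orbitSOS_mem (hp : IsBasicInvariants G p) (a : EuclideanSpace ℝ (Fin n)) :
    orbitSOS p a ∈ invariantPolynomials G :=
  Subalgebra.sum_mem _ fun i _ => Subalgebra.pow_mem _
    (Subalgebra.sub_mem _ (hp.mem i) (Subalgebra.algebraMap_mem _ _)) 2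

theorem realZeros_orbitSOS [Finite G] (hp : IsBasicInvariants G p)
    (a : EuclideanSpace ℝ (Fin n)) : realZeros (orbitSOS p a) = {x | ∃ g ∈ G, x = g a} := by
  ext x
  have h1 : x ∈ realZeros (orbitSOS p a) ↔ orbitMap p x = orbitMap p a := by
    simp only [realZeros, Set.mem_ofPred_eq, orbitSOS, polyValue, map_sum, map_pow, map_sub, eval_C]
    rw [Finset.sum_eq_zero_iff_of_nonneg (fun _ _ => sq_nonneg _)]
    simp [sub_eq_zero, funext_iff, orbitMap, polyValue]
  rw [h1]
  constructor
  · intro h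
    refine eq_orbit_of_forall_invariant fun f hf => ?_
    obtain ⟨F, rfl⟩ := hp.exists_aeval_eq hf
    rw [polyValue_aeval, polyValue_aeval, h]
  · rintro ⟨g, hg, rfl⟩
    funext i
    have := hp.mem i g⁻¹ (G.inv_mem hg) a
    rwa [inv_inv] at this

/-- The component in degree `2 * (p l).totalDegree` is the sum of the squares of the invariants of
top degree. Over the reals its vanishing would force `p l = 0`. -/
theorem totalDegree_orbitSOS (hess : IsEssentialGroup G) (hp : IsBasicInvariants G p)
    (a : EuclideanSpace ℝ (Fin n)) {l : Fin n} (hl : ∀ i, i ≤ l) :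
    (orbitSOS p a).totalDegree = 2 * (p l).totalDegree := by
  have hd := hp.two_le_totalDegree hess
  have hmono : ∀ i, (p i).totalDegree ≤ (p l).totalDegree := fun i => hp.degree_mono (hl i)
  refine le_antisymm ?_ ?_
  · refine totalDegree_finsetSum_le fun i _ => (totalDegree_pow _ _).trans ?_
    refine Nat.mul_le_mul_left 2 ((totalDegree_sub _ _).trans ?_)
    simpa using hmono i
  by_contra! hlt
  have h0 := homogeneousComponent_eq_zero _ _ hlt
  have hcomp : ∀ i, homogeneousComponent (2 * (p l).totalDegree)
      ((p i - C (polyValue (p i) a)) ^ 2) =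
      if (p i).totalDegree = (p l).totalDegree then p i ^ 2 else 0 := by
    intro i
    have h2 : (p i - C (polyValue (p i) a)) ^ 2 =
        p i ^ 2 - C (2 * polyValue (p i) a) * p i + C (polyValue (p i) a ^ 2) := by
      simp only [map_mul, map_pow, map_ofNat]
      ring
    have hdi := hd i
    have hdl := hd l
    have hm := hmono i
    rw [h2, map_add, map_sub,
      homogeneousComponent_of_mem ((mem_homogeneousSubmodule _ _).2 ((hp.homogeneous i).pow 2)),
      homogeneousComponent_of_mem ((mem_homogeneousSubmodule _ _).2 ((hp.homogeneous i).C_mul _)),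
      homogeneousComponent_of_mem ((mem_homogeneousSubmodule _ _).2 (isHomogeneous_C _ _)),
      if_neg (by omega : ¬ 2 * (p l).totalDegree = (p i).totalDegree),
      if_neg (by omega : ¬ 2 * (p l).totalDegree = 0), sub_zero, add_zero]
    exact if_congr (by omega) rfl rfl
  rw [orbitSOS, map_sum, Finset.sum_congr rfl fun i _ => hcomp i] at h0
  refine hp.algebraicIndependent.ne_zero l (polyValue_ext fun x => ?_)
  have h1 := congrArg (eval fun i => x i) h0
  rw [map_sum, map_zero, Finset.sum_eq_zero_iff_of_nonneg] at h1
  · have := h1 l (Finset.mem_univ l)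
    simpa [polyValue] using this
  · intro i _
    split_ifs
    · rw [map_pow]
      exact sq_nonneg _
    · simp

end Main

end

theorem corollary3p6 (n : ℕ) (hn : 2 ≤ n)
    (G : Subgroup (EuclideanSpace ℝ (Fin n) ≃ₗᵢ[ℝ] EuclideanSpace ℝ (Fin n)))
    (hG : IsReflectionGroup G) (hess : IsEssentialGroup G)
    (p : Fin n → MvPolynomial (Fin n) ℝ) (hp : IsBasicInvariants G p) :
    -- the two equivalences below the degree bound
    (∀ f ∈ invariantPolynomials G,
      f.totalDegree < 2 * (p ⟨n - 1, by omega⟩).totalDegree →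
        ((realZeros f).Nonempty ↔ (realZeros f ∩ arrangementPoints G).Nonempty) ∧
        ((∀ x, 0 ≤ polyValue f x) ↔ ∀ x ∈ arrangementPoints G, 0 ≤ polyValue f x)) ∧
    -- tightness of the bound
    (∃ a, a ∉ arrangementPoints G) ∧
    (∀ a, a ∉ arrangementPoints G →
      ∀ f : MvPolynomial (Fin n) ℝ,
        f = ∑ i, (p i - MvPolynomial.C (polyValue (p i) a)) ^ 2 →
          f ∈ invariantPolynomials G ∧
          f.totalDegree = 2 * (p ⟨n - 1, by omega⟩).totalDegree ∧
          realZeros f = {x | ∃ g ∈ G, x = g a} ∧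
          (realZeros f).Nonempty ∧
          realZeros f ∩ arrangementPoints G = ∅) := by
  have := hG.finite
  refine ⟨fun f hf hdeg => ⟨⟨?_, fun h => h.mono Set.inter_subset_left⟩,
    fun h x _ => h x, fun h x => ?_⟩, exists_notMem_arrangementPoints, ?_⟩
  · rintro ⟨x, hx⟩
    have hx0 : polyValue f x = 0 := hx
    obtain ⟨⟨y₁, hy₁, h₁⟩, y₂, hy₂, h₂⟩ :=
      exists_arrangementPoints_le_and_le hn hess hp hf hdeg x
    rw [hx0] at h₁ h₂
    obtain ⟨y, hy, hy0⟩ := exists_zero_mem_arrangementPoints hy₁ hy₂ h₁ h₂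
    exact ⟨y, hy0, hy⟩
  · obtain ⟨⟨y, hy, hle⟩, -⟩ := exists_arrangementPoints_le_and_le hn hess hp hf hdeg x
    exact (h y hy).trans hle
  · rintro a ha f rfl
    have hz := realZeros_orbitSOS hp a
    refine ⟨orbitSOS_mem hp a, totalDegree_orbitSOS hess hp a fun i => ?_, hz, ?_, ?_⟩
    · rw [Fin.le_def]
      change i.1 ≤ n - 1
      omega
    · exact ⟨a, hz.symm ▸ ⟨1, G.one_mem, rfl⟩⟩
    · rw [Set.eq_empty_iff_forall_notMem]
      rintro x ⟨hx, hxH⟩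
      obtain ⟨g, hg, rfl⟩ := (Set.ext_iff.1 hz x).1 hx
      exact ha (mem_arrangementPoints_of_apply_mem hg hxH)
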